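/- Let $P$ be a left cancellative semigroup. For $p,q\in P$ and $X\subseteq P$ put $p(X)=\{px : x\in X\}$ and $q^{-1}(X)=\{y\in P : qy\in X\}$. Let $\mathcal J_P$, the set of constructible right ideals of $P$, be the smallest family of subsets of $P$ that contains $P$ and is closed under $X\mapsto p(X)$ and $X\mapsto q^{-1}(X)$ for all $p,q\in P$. We say that $P$ satisfies independence if for all $n\ge 1$ and all $X,X_1,\dots,X_n\in\mathcal J_P$, the equality $X=\bigcup_{i=1}^n X_i$ implies $X=X_i$ for some $1\le i\le n$. Let $\Gamma=(V,E)$ be an undirected graph without loops or multiple edges, with $E$ viewed as a symmetric subset of $V\times V$, and for every $v\in V$ let $P_v$ be a submonoid of a group $G_v$. Let $\Gamma_{v\in V}P_v$ be the graph product, that is, the monoid obtained from the free product $*_{v\in V}P_v$ by imposing the relations $xy=yx$ for all $x\in P_v$, $y\in P_w$ with $(v,w)\in E$. **Proposition.** If for every $v\in V$ the semigroup $P_v$ satisfies independence, then the graph product $\Gamma_{v\in V}P_v$ (is left cancellative and) satisfies independence. -/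

import Mathlib

/-- The constructible right ideals of a (left cancellative) semigroup `P`: the subsets of `P` obtained
from `P` itself by finitely many operations `X ↦ p(X) = {p * x | x ∈ X}` and
`X ↦ q⁻¹(X) = {y | q * y ∈ X}`, with `p, q ∈ P`. -/
inductive IsConstructibleRightIdeal {P : Type*} [Semigroup P] : Set P → Prop
  | whole : IsConstructibleRightIdeal Set.univ
  | image (p : P) {X : Set P} (hX : IsConstructibleRightIdeal X) :
      IsConstructibleRightIdeal ((fun x => p * x) '' X)
  | preimage (q : P) {X : Set P} (hX : IsConstructibleRightIdeal X) :
      IsConstructibleRightIdeal ((fun y => q * y) ⁻¹' X)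

/-- `P` is a left cancellative semigroup that satisfies the independence condition: whenever a
constructible right ideal `X` is the union of constructible right ideals `X₁, …, Xₙ` with `n ≥ 1`,
it is equal to one of them. -/
structure SatisfiesIndependence (P : Type*) [Semigroup P] : Prop where
  leftCancel : IsLeftCancelMul P
  eq_of_eq_iUnion : ∀ (n : ℕ) (X : Set P) (Y : Fin n → Set P), 1 ≤ n →
    IsConstructibleRightIdeal X → (∀ i, IsConstructibleRightIdeal (Y i)) →
    X = ⋃ i, Y i → ∃ i, X = Y i

/-- The relations `x * y = y * x` in the free product of the monoids `M v`, for `x ∈ M v` and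
`y ∈ M w` with `v`, `w` adjacent. -/
inductive GraphProductRel {V : Type*} (Γ : SimpleGraph V) (M : V → Type*) [∀ v, Monoid (M v)] :
    Monoid.CoprodI M → Monoid.CoprodI M → Prop
  | comm {v w : V} (h : Γ.Adj v w) (x : M v) (y : M w) :
      GraphProductRel Γ M (Monoid.CoprodI.of x * Monoid.CoprodI.of y)
        (Monoid.CoprodI.of y * Monoid.CoprodI.of x)

/-- The graph product of the monoids `M v` over the graph `Γ`: the quotient of their free product by
the congruence generated by the commutation relations along the edges of `Γ`. -/
def GraphProduct {V : Type*} (Γ : SimpleGraph V) (M : V → Type*) [∀ v, Monoid (M v)] : Type _ :=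
  (conGen (GraphProductRel Γ M)).Quotient

instance GraphProduct.instMonoid {V : Type*} (Γ : SimpleGraph V) (M : V → Type*)
    [∀ v, Monoid (M v)] : Monoid (GraphProduct Γ M) :=
  inferInstanceAs (Monoid (conGen (GraphProductRel Γ M)).Quotient)

/-! Every element of a graph product has a reduced word, unique up to exchanging adjacent commuting
syllables. Hence it has at each vertex `u` a well-defined initial part `head u x` and a remainder
`tail u x`. Left multiplication by `of u m` multiplies the head at `u` by `m` and fixes the tail,
and two distinct nonadjacent vertices cannot both have nontrivial heads.

With this, every constructible right ideal is empty, or a cylinder, cut out by constructible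
conditions on the heads, or an injective shift of a simpler such set by one syllable
(`isStandard_of_isConstructible`). A shift by `u` is admitted only if every shifted element has
trivial head at `u` and a syllable away from the neighbours of `u`; so no shift contains a product
of syllables over a clique.

Independence for a shift follows from independence for the simpler set by cancelling the syllable.
In a nonempty cylinder, the vertices with a proper condition form a finite clique. Independence of
the vertex monoids gives at each of them a value that avoids the finitely many strictly smaller
conditions; the product of these values lies in some member of the union, which must then be the
whole cylinder (`exists_eq_of_cylinder_eq_iUnion`). -/

namespace GraphProduct

/-! ### Shuffle equivalence of words. -/

section Shuffle

variable {V : Type*} (Γ : SimpleGraph V) {M : V → Type*}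

/-- Equality of words up to exchanging neighbouring syllables at adjacent vertices. -/
inductive Shuffle : List (Σ v, M v) → List (Σ v, M v) → Prop
  | nil : Shuffle [] []
  | cons (a : Σ v, M v) {l l' : List (Σ v, M v)} : Shuffle l l' → Shuffle (a :: l) (a :: l')
  | swap {v w : V} (h : Γ.Adj v w) (x : M v) (y : M w) (l : List (Σ v, M v)) :
      Shuffle (⟨v, x⟩ :: ⟨w, y⟩ :: l) (⟨w, y⟩ :: ⟨v, x⟩ :: l)
  | trans {l₁ l₂ l₃ : List (Σ v, M v)} : Shuffle l₁ l₂ → Shuffle l₂ l₃ → Shuffle l₁ l₃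

variable {Γ}

theorem Shuffle.refl (l : List (Σ v, M v)) : Shuffle Γ l l := by
  induction l with
  | nil => exact .nil
  | cons a l ih => exact .cons a ih

theorem Shuffle.symm {l l' : List (Σ v, M v)} (h : Shuffle Γ l l') : Shuffle Γ l' l := by
  induction h with
  | nil => exact .nil
  | cons a _ ih => exact .cons a ih
  | swap h x y l => exact .swap h.symm y x l
  | trans _ _ ih₁ ih₂ => exact .trans ih₂ ih₁

theorem Shuffle.perm {l l' : List (Σ v, M v)} (h : Shuffle Γ l l') : l.Perm l' := by
  induction h with
  | nil => exact .nil
  | cons a _ ih => exact .cons a ih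
  | swap h x y l => exact .swap _ _ _
  | trans _ _ ih₁ ih₂ => exact .trans ih₁ ih₂

end Shuffle

/-! ### Reduced words and normal forms. -/

section Words

variable {V : Type*} (Γ : SimpleGraph V) {M : V → Type*} [∀ v, Monoid (M v)]

open scoped Classical in
/-- Splits off the first syllable of a word at the vertex `u` if it can be shuffled to the front. -/
noncomputable def extract (u : V) : List (Σ v, M v) → M u × List (Σ v, M v)
  | [] => (1, [])
  | ⟨w, x⟩ :: l =>
    if h : w = u then (h ▸ x, l)
    else if Γ.Adj w u then ((extract u l).1, ⟨w, x⟩ :: (extract u l).2)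
    else (1, ⟨w, x⟩ :: l)

@[simp] theorem extract_nil (u : V) : extract Γ u ([] : List (Σ v, M v)) = (1, []) := rfl

@[simp] theorem extract_cons_self (u : V) (x : M u) (l : List (Σ v, M v)) :
    extract Γ u (⟨u, x⟩ :: l) = (x, l) := by
  simp [extract]

variable {Γ}

theorem extract_cons_adj {u w : V} (h : Γ.Adj w u) (x : M w) (l : List (Σ v, M v)) :
    extract Γ u (⟨w, x⟩ :: l) = ((extract Γ u l).1, ⟨w, x⟩ :: (extract Γ u l).2) := by
  simp [extract, h, h.ne]

theorem extract_cons_not_adj {u w : V} (hne : w ≠ u) (h : ¬ Γ.Adj w u) (x : M w)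
    (l : List (Σ v, M v)) : extract Γ u (⟨w, x⟩ :: l) = (1, ⟨w, x⟩ :: l) := by
  simp [extract, h, hne]

theorem Shuffle.extract {l l' : List (Σ v, M v)} (h : Shuffle Γ l l') (u : V) :
    (extract Γ u l).1 = (extract Γ u l').1 ∧
      Shuffle Γ (GraphProduct.extract Γ u l).2 (GraphProduct.extract Γ u l').2 := by
  induction h with
  | nil => exact ⟨rfl, .nil⟩
  | @cons a l l' h ih =>
    obtain ⟨w, x⟩ := a
    by_cases hw : w = u
    · subst hw
      simpa using h
    by_cases ha : Γ.Adj w u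
    · simp only [extract_cons_adj ha]
      exact ⟨ih.1, .cons _ ih.2⟩
    · simp only [extract_cons_not_adj hw ha]
      exact ⟨trivial, .cons _ h⟩
  | @swap v w h x y l =>
    by_cases hv : v = u
    · subst hv
      simpa [extract_cons_adj h.symm] using Shuffle.refl _
    by_cases hw : w = u
    · subst hw
      simpa [extract_cons_adj h] using Shuffle.refl _
    by_cases hav : Γ.Adj v u <;> by_cases haw : Γ.Adj w u
    · simpa [extract_cons_adj hav, extract_cons_adj haw] using .swap h x y _
    · simpa [extract_cons_adj hav, extract_cons_not_adj hw haw] using .swap h x y _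
    · simpa [extract_cons_adj haw, extract_cons_not_adj hv hav] using .swap h x y _
    · simpa [extract_cons_not_adj hv hav, extract_cons_not_adj hw haw] using .swap h x y _
  | trans _ _ ih₁ ih₂ => exact ⟨ih₁.1.trans ih₂.1, ih₁.2.trans ih₂.2⟩

variable (Γ)

/-- A word is reduced if all its syllables are nontrivial and no syllable can be merged with a
later one. -/
def IsReduced : List (Σ v, M v) → Prop
  | [] => True
  | a :: l => a.2 ≠ 1 ∧ (extract Γ a.1 l).1 = 1 ∧ IsReduced l

open scoped Classical in
/-- Puts a syllable in front of a word, unless it is trivial. -/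
noncomputable def consSyllable (u : V) (m : M u) (l : List (Σ v, M v)) : List (Σ v, M v) :=
  if m = 1 then l else ⟨u, m⟩ :: l

variable {Γ}

@[simp] theorem consSyllable_one (u : V) (l : List (Σ v, M v)) :
    consSyllable u (1 : M u) l = l := by
  simp [consSyllable]

theorem consSyllable_of_ne {u : V} {m : M u} (hm : m ≠ 1) (l : List (Σ v, M v)) :
    consSyllable u m l = ⟨u, m⟩ :: l := by
  simp [consSyllable, hm]

theorem Shuffle.consSyllable {l l' : List (Σ v, M v)} (h : Shuffle Γ l l') (u : V) (m : M u) :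
    Shuffle Γ (consSyllable u m l) (consSyllable u m l') := by
  unfold GraphProduct.consSyllable
  split_ifs
  · exact h
  · exact .cons _ h

theorem extract_consSyllable_adj {u w : V} (h : Γ.Adj w u) (x : M w) (l : List (Σ v, M v)) :
    extract Γ u (consSyllable w x l) =
      ((extract Γ u l).1, consSyllable w x (extract Γ u l).2) := by
  unfold consSyllable
  split_ifs
  · rfl
  · exact extract_cons_adj h x l

theorem IsReduced.extract {l : List (Σ v, M v)} (hl : IsReduced Γ l) (u : V) :
    IsReduced Γ (extract Γ u l).2 ∧
      (GraphProduct.extract Γ u (GraphProduct.extract Γ u l).2).1 = 1 ∧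
      Shuffle Γ (consSyllable u (GraphProduct.extract Γ u l).1 (GraphProduct.extract Γ u l).2)
        l := by
  induction l with
  | nil => simpa [IsReduced] using Shuffle.nil
  | cons a l ih =>
    obtain ⟨w, x⟩ := a
    obtain ⟨hx, hw, hl'⟩ := hl
    obtain ⟨ih₁, ih₂, ih₃⟩ := ih hl'
    by_cases hwu : w = u
    · subst hwu
      rw [extract_cons_self, consSyllable_of_ne hx]
      exact ⟨hl', hw, .refl _⟩
    by_cases ha : Γ.Adj w u
    · simp only [extract_cons_adj ha]
      refine ⟨⟨hx, ?_, ih₁⟩, ih₂, ?_⟩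
      · have := (ih₃.extract w).1
        rw [extract_consSyllable_adj ha.symm] at this
        exact this.trans hw
      · refine .trans ?_ (.cons _ ih₃)
        unfold GraphProduct.consSyllable
        split_ifs
        · exact .refl _
        · exact .swap ha.symm _ _ _
    · simp only [extract_cons_not_adj hwu ha, consSyllable_one]
      exact ⟨⟨hx, hw, hl'⟩, trivial, .refl _⟩

theorem IsReduced.consSyllable {l : List (Σ v, M v)} (hl : IsReduced Γ l) {u : V}
    (hu : (GraphProduct.extract Γ u l).1 = 1) (m : M u) : IsReduced Γ (consSyllable u m l) := by
  unfold GraphProduct.consSyllable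
  split_ifs with h
  · exact hl
  · exact ⟨h, hu, hl⟩

theorem IsReduced.extract_consSyllable {l : List (Σ v, M v)} (hl : IsReduced Γ l) {u : V}
    (hu : (GraphProduct.extract Γ u l).1 = 1) (m : M u) :
    (GraphProduct.extract Γ u (GraphProduct.consSyllable u m l)).1 = m ∧
      Shuffle Γ (GraphProduct.extract Γ u (GraphProduct.consSyllable u m l)).2 l := by
  unfold GraphProduct.consSyllable
  split_ifs with h
  · refine ⟨hu.trans h.symm, ?_⟩
    simpa [hu] using (hl.extract u).2.2
  · simpa using Shuffle.refl l

/-- Whichever of the two vertices occurs first blocks the other, unless an earlier syllable already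
blocks one of them. -/
theorem extract_eq_one_or {u v : V} (hne : u ≠ v) (h : ¬ Γ.Adj u v) (l : List (Σ v, M v)) :
    (extract Γ u l).1 = 1 ∨ (extract Γ v l).1 = 1 := by
  induction l with
  | nil => exact .inl rfl
  | cons a l ih =>
    obtain ⟨w, x⟩ := a
    by_cases hwu : w = u
    · subst hwu
      exact .inr (by rw [extract_cons_not_adj hne h])
    by_cases hwv : w = v
    · subst hwv
      exact .inl (by rw [extract_cons_not_adj hne.symm (fun h' => h h'.symm)])
    by_cases hau : Γ.Adj w u
    · by_cases hav : Γ.Adj w v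
      · simpa only [extract_cons_adj hau, extract_cons_adj hav] using ih
      · exact .inr (by rw [extract_cons_not_adj hwv hav])
    · exact .inl (by rw [extract_cons_not_adj hwu hau])

variable (Γ M)

/-- Reduced words up to shuffling. -/
def shuffleSetoid : Setoid {l : List (Σ v, M v) // IsReduced Γ l} where
  r l l' := Shuffle Γ l.1 l'.1
  iseqv := ⟨fun l => .refl l.1, fun h => h.symm, fun h h' => h.trans h'⟩

/-- The normal forms of the elements of a graph product. -/
def NormalForm : Type _ := Quotient (shuffleSetoid Γ M)

variable {Γ M}

namespace NormalForm

/-- The normal form of the identity. -/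
def empty : NormalForm Γ M := Quotient.mk (shuffleSetoid Γ M) ⟨[], trivial⟩

/-- The initial part of a normal form at the vertex `u`. -/
noncomputable def head (u : V) : NormalForm Γ M → M u :=
  Quotient.lift (fun l => (extract Γ u l.1).1) fun _ _ h => (Shuffle.extract h u).1

/-- What remains of a normal form when its initial part at `u` is removed. -/
noncomputable def tail (u : V) : NormalForm Γ M → NormalForm Γ M :=
  Quotient.map (sa := shuffleSetoid Γ M) (sb := shuffleSetoid Γ M)
    (fun l => ⟨(extract Γ u l.1).2, (l.2.extract u).1⟩) fun _ _ h => (Shuffle.extract h u).2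

/-- Left multiplication of a normal form by an element of a vertex monoid. -/
noncomputable def push (u : V) (m : M u) : NormalForm Γ M → NormalForm Γ M :=
  Quotient.map (sa := shuffleSetoid Γ M) (sb := shuffleSetoid Γ M)
    (fun l => ⟨consSyllable u (m * (extract Γ u l.1).1) (extract Γ u l.1).2,
      (l.2.extract u).1.consSyllable (l.2.extract u).2.1 _⟩) fun l l' h => by
    obtain ⟨h₁, h₂⟩ := Shuffle.extract h u
    change Shuffle Γ (consSyllable _ _ _) (consSyllable _ _ _)
    rw [h₁]
    exact h₂.consSyllable _ _

/-- The set of vertices that occur in a normal form. -/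
def support : NormalForm Γ M → Set V :=
  Quotient.lift (fun l => {v | ∃ a ∈ l.1, a.1 = v}) fun l l' h => by
    ext v
    simp only [Set.mem_ofPred_eq, (Shuffle.perm h).mem_iff]

theorem head_push_self (u : V) (m : M u) (x : NormalForm Γ M) :
    head u (push u m x) = m * head u x := by
  induction x using Quotient.inductionOn with
  | h l => exact ((l.2.extract u).1.extract_consSyllable (l.2.extract u).2.1 _).1

theorem tail_push_self (u : V) (m : M u) (x : NormalForm Γ M) :
    tail u (push u m x) = tail u x := by
  induction x using Quotient.inductionOn with
  | h l =>
    exact Quotient.sound ((l.2.extract u).1.extract_consSyllable (l.2.extract u).2.1 _).2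

theorem head_tail (u : V) (x : NormalForm Γ M) : head u (tail u x) = 1 := by
  induction x using Quotient.inductionOn with
  | h l => exact (l.2.extract u).2.1

theorem push_head_tail (u : V) (x : NormalForm Γ M) : push u (head u x) (tail u x) = x := by
  induction x using Quotient.inductionOn with
  | h l =>
    obtain ⟨h₁, h₂, h₃⟩ := l.2.extract u
    refine Quotient.sound (Shuffle.trans ?_ h₃)
    change Shuffle Γ (consSyllable u (_ * (extract Γ u (extract Γ u l.1).2).1) _) _
    rw [h₂, mul_one]
    refine Shuffle.consSyllable ?_ u _
    simpa [h₂] using (h₁.extract u).2.2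

theorem head_push_adj {u v : V} (h : Γ.Adj v u) (m : M v) (x : NormalForm Γ M) :
    head u (push v m x) = head u x := by
  induction x using Quotient.inductionOn with
  | h l =>
    have := ((l.2.extract v).2.2.extract u).1
    rw [extract_consSyllable_adj h] at this
    change (extract Γ u (consSyllable v _ _)).1 = _
    rw [extract_consSyllable_adj h]
    exact this

theorem head_ne_one {u v : V} (hne : u ≠ v) (h : ¬ Γ.Adj u v) {x : NormalForm Γ M}
    (hx : head u x ≠ 1) : head v x = 1 := by
  induction x using Quotient.inductionOn with
  | h l => exact (extract_eq_one_or hne h l.1).resolve_left hx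

/-- Pushing at `u` changes only the head at `u`, so identities between pushes can be checked on
heads and tails. -/
theorem ext_at (u : V) {x y : NormalForm Γ M} (h : head u x = head u y)
    (h' : tail u x = tail u y) : x = y := by
  rw [← push_head_tail u x, h, h', push_head_tail]

theorem push_one (u : V) (x : NormalForm Γ M) : push u 1 x = x :=
  ext_at u (by rw [head_push_self, one_mul]) (tail_push_self u 1 x)

theorem push_mul (u : V) (m n : M u) (x : NormalForm Γ M) :
    push u (m * n) x = push u m (push u n x) :=
  ext_at u (by simp only [head_push_self, mul_assoc]) (by simp only [tail_push_self])

/-- Removing the initial parts at `u` and at `v` in either order leaves the same word up to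
shuffling, and removing the one at `u` does not affect the one at `v`. -/
theorem tail_push_adj {u v : V} (h : Γ.Adj v u) (m : M v) (x : NormalForm Γ M) :
    tail u (push v m x) = push v m (tail u x) := by
  induction x using Quotient.inductionOn with
  | h l =>
    refine Quotient.sound ?_
    change Shuffle Γ (extract Γ u (consSyllable v _ _)).2 (consSyllable v _ _)
    obtain ⟨h₁, h₂⟩ := ((l.2.extract v).2.2.extract u)
    rw [extract_consSyllable_adj h] at h₁ h₂ ⊢
    obtain ⟨h₃, h₄⟩ := h₂.extract v
    have hr := (l.2.extract v).1
    have hv : (extract Γ v (extract Γ u (extract Γ v l.1).2).2).1 = 1 := by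
      have := ((hr.extract u).2.2.extract v).1
      rw [extract_consSyllable_adj h.symm] at this
      exact this.trans (l.2.extract v).2.1
    obtain ⟨h₅, h₆⟩ := (hr.extract u).1.extract_consSyllable hv (extract Γ v l.1).1
    rw [← h₃, h₅]
    exact (h₆.symm.trans h₄).consSyllable _ _

theorem push_comm {u v : V} (h : Γ.Adj v u) (m : M v) (n : M u) (x : NormalForm Γ M) :
    push v m (push u n x) = push u n (push v m x) :=
  ext_at u (by simp only [head_push_adj h, head_push_self])
    (by simp only [tail_push_adj h, tail_push_self])

theorem push_of_head_eq_one {u : V} {x : NormalForm Γ M} (h : head u x = 1) :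
    tail u x = x := by
  conv_rhs => rw [← push_head_tail u x, h, push_one]

theorem support_push_of_head_eq_one {u : V} {m : M u} (hm : m ≠ 1) {x : NormalForm Γ M}
    (h : head u x = 1) : support (push u m x) = insert u (support x) := by
  have hx := push_of_head_eq_one h
  rw [← hx]
  induction x using Quotient.inductionOn with
  | h l =>
    have h' : (extract Γ u l.1).1 = 1 := h
    rw [show push u m (tail u _) = push u m _ from congrArg _ hx]
    change {v | ∃ a ∈ consSyllable u (m * (extract Γ u l.1).1) (extract Γ u l.1).2, a.1 = v} =
      insert u {v | ∃ a ∈ (extract Γ u l.1).2, a.1 = v}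
    rw [h', mul_one, consSyllable_of_ne hm]
    ext v
    simp [eq_comm]

end NormalForm

end Words

/-! ### Normal form theorem; heads, tails and supports of elements. -/

section Elements

variable {V : Type*} {Γ : SimpleGraph V} {M : V → Type*} [∀ v, Monoid (M v)]

/-- The projection from the free product to the graph product. -/
def mk : Monoid.CoprodI M →* GraphProduct Γ M := (conGen (GraphProductRel Γ M)).mk'

/-- The canonical homomorphism from a vertex monoid to the graph product. -/
def of (v : V) : M v →* GraphProduct Γ M :=
  mk.comp Monoid.CoprodI.of

theorem of_mul_of_comm {v w : V} (h : Γ.Adj v w) (x : M v) (y : M w) :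
    (of v x * of w y : GraphProduct Γ M) = of w y * of v x :=
  (Con.eq _).2 (ConGen.Rel.of _ _ (GraphProductRel.comm h x y))

theorem of_mul_left_comm {v w : V} (h : Γ.Adj v w) (x : M v) (y : M w) (z : GraphProduct Γ M) :
    of v x * (of w y * z) = of w y * (of v x * z) := by
  rw [← mul_assoc, of_mul_of_comm h, mul_assoc]

theorem induction_of {p : GraphProduct Γ M → Prop} (one : p 1)
    (of_mul : ∀ (v : V) (m : M v) (x : GraphProduct Γ M), p x → p (of v m * x))
    (x : GraphProduct Γ M) : p x := by
  obtain ⟨x, rfl⟩ : ∃ z, mk z = x := Con.mk'_surjective x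
  suffices h : ∀ y : GraphProduct Γ M, p y → p (mk x * y) by
    simpa using h 1 one
  induction x using Monoid.CoprodI.induction_on with
  | one =>
    intro y hy
    rw [map_one]
    rwa [one_mul]
  | of v m => exact fun y hy => of_mul v m y hy
  | mul a b ha hb =>
    intro y hy
    rw [map_mul, mul_assoc]
    exact ha _ (hb _ hy)

/-- The action of the graph product on normal forms. -/
noncomputable def act : GraphProduct Γ M →* Function.End (NormalForm Γ M) :=
  Con.lift (conGen (GraphProductRel Γ M))
    (Monoid.CoprodI.lift fun v =>
      { toFun := fun m => NormalForm.push v m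
        map_one' := funext fun x => NormalForm.push_one v x
        map_mul' := fun m n => funext fun x => NormalForm.push_mul v m n x })
    (Con.conGen_le.2 fun _ _ h => by
      obtain ⟨h, x, y⟩ := h
      rw [Con.ker_rel, map_mul, map_mul]
      simp only [Monoid.CoprodI.lift_of]
      exact funext fun z => NormalForm.push_comm h x y z)

theorem act_of (v : V) (m : M v) (x : NormalForm Γ M) :
    act (of v m) x = x.push v m := by
  have h : (act (of v m : GraphProduct Γ M) : Function.End (NormalForm Γ M)) =
      NormalForm.push v m := Monoid.CoprodI.lift_of _ _
  exact congrFun h x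

/-- The normal form of an element of the graph product. -/
noncomputable def normalForm (x : GraphProduct Γ M) : NormalForm Γ M := act x .empty

theorem normalForm_of_mul (v : V) (m : M v) (x : GraphProduct Γ M) :
    normalForm (of v m * x) = (normalForm x).push v m := by
  unfold normalForm
  rw [map_mul]
  exact act_of v m _

/-- The product of the syllables of a word. -/
def wordProd (l : List (Σ v, M v)) : GraphProduct Γ M := (l.map fun a => of a.1 a.2).prod

theorem wordProd_cons (a : Σ v, M v) (l : List (Σ v, M v)) :
    (wordProd (a :: l) : GraphProduct Γ M) = of a.1 a.2 * wordProd l := by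
  simp [wordProd]

theorem wordProd_consSyllable (u : V) (m : M u) (l : List (Σ v, M v)) :
    (wordProd (consSyllable u m l) : GraphProduct Γ M) = of u m * wordProd l := by
  unfold consSyllable
  split_ifs with h
  · simp [h]
  · exact wordProd_cons _ l

theorem Shuffle.wordProd {l l' : List (Σ v, M v)} (h : Shuffle Γ l l') :
    (wordProd l : GraphProduct Γ M) = GraphProduct.wordProd l' := by
  induction h with
  | nil => rfl
  | cons a _ ih => rw [wordProd_cons, wordProd_cons, ih]
  | swap h x y l => simp only [wordProd_cons, of_mul_left_comm h]
  | trans _ _ ih₁ ih₂ => exact ih₁.trans ih₂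

/-- The element of the graph product with a given normal form. -/
def NormalForm.value : NormalForm Γ M → GraphProduct Γ M :=
  Quotient.lift (fun l => wordProd l.1) fun _ _ h => Shuffle.wordProd h

theorem NormalForm.value_push (u : V) (m : M u) (x : NormalForm Γ M) :
    (x.push u m).value = of u m * x.value := by
  induction x using Quotient.inductionOn with
  | h l =>
    change wordProd (consSyllable u _ _) = of u m * wordProd l.1
    rw [wordProd_consSyllable, map_mul, mul_assoc, ← wordProd_consSyllable,
      (l.2.extract u).2.2.wordProd]

theorem value_normalForm (x : GraphProduct Γ M) : (normalForm x).value = x := by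
  induction x using induction_of with
  | one =>
    unfold normalForm
    rw [map_one]
    rfl
  | of_mul v m x ih => rw [normalForm_of_mul, NormalForm.value_push, ih]

/-- Uniqueness of normal forms: when a reduced word is rebuilt from the right, each new syllable
meets a trivial head, so nothing merges. -/
theorem normalForm_value (x : NormalForm Γ M) : normalForm x.value = x := by
  induction x using Quotient.inductionOn with
  | h l =>
    obtain ⟨l, hl⟩ := l
    induction l with
    | nil => exact congrFun (map_one (act (Γ := Γ) (M := M))) _
    | cons a l ih =>
      change normalForm (wordProd (a :: l)) = _
      rw [wordProd_cons, normalForm_of_mul]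
      have := ih hl.2.2
      change normalForm (wordProd l) = _ at this
      rw [this]
      refine Quotient.sound ?_
      change Shuffle Γ (consSyllable a.1 (a.2 * (extract Γ a.1 l).1) (extract Γ a.1 l).2) (a :: l)
      have h := (hl.2.2.extract a.1).2.2
      rw [hl.2.1, consSyllable_one] at h
      rw [hl.2.1, mul_one, consSyllable_of_ne hl.1]
      exact .cons _ h

/-- The initial part of `x` at the vertex `u`. -/
noncomputable def head (u : V) (x : GraphProduct Γ M) : M u := (normalForm x).head u

/-- What remains of `x` when its initial part at the vertex `u` is removed. -/
noncomputable def tail (u : V) (x : GraphProduct Γ M) : GraphProduct Γ M :=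
  ((normalForm x).tail u).value

/-- The set of vertices that occur in the normal form of `x`. -/
noncomputable def support (x : GraphProduct Γ M) : Set V := (normalForm x).support

@[simp] theorem head_one (u : V) : head u (1 : GraphProduct Γ M) = 1 := by
  unfold head normalForm
  rw [map_one]
  rfl

theorem support_one : support (1 : GraphProduct Γ M) = ∅ := by
  unfold support normalForm
  rw [map_one]
  change {v | ∃ a ∈ ([] : List (Σ v, M v)), a.1 = v} = ∅
  simp

theorem of_head_mul_tail (u : V) (x : GraphProduct Γ M) : of u (head u x) * tail u x = x := by
  unfold head tail
  rw [← NormalForm.value_push, NormalForm.push_head_tail, value_normalForm]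

@[simp] theorem head_of_mul_self (u : V) (m : M u) (x : GraphProduct Γ M) :
    head u (of u m * x) = m * head u x := by
  rw [head, normalForm_of_mul, NormalForm.head_push_self, head]

@[simp] theorem tail_of_mul_self (u : V) (m : M u) (x : GraphProduct Γ M) :
    tail u (of u m * x) = tail u x := by
  rw [tail, normalForm_of_mul, NormalForm.tail_push_self, tail]

@[simp] theorem head_tail (u : V) (x : GraphProduct Γ M) : head u (tail u x) = 1 := by
  rw [head, tail, normalForm_value, NormalForm.head_tail]

theorem head_of_mul_adj {u v : V} (h : Γ.Adj v u) (m : M v) (x : GraphProduct Γ M) :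
    head u (of v m * x) = head u x := by
  rw [head, normalForm_of_mul, NormalForm.head_push_adj h, head]

theorem tail_of_mul_adj {u v : V} (h : Γ.Adj v u) (m : M v) (x : GraphProduct Γ M) :
    tail u (of v m * x) = of v m * tail u x := by
  rw [tail, normalForm_of_mul, NormalForm.tail_push_adj h, NormalForm.value_push, tail]

theorem head_eq_one_of_not_adj {u v : V} (hne : u ≠ v) (h : ¬ Γ.Adj u v) {x : GraphProduct Γ M}
    (hx : head u x ≠ 1) : head v x = 1 :=
  NormalForm.head_ne_one hne h hx

theorem tail_eq_self {u : V} {x : GraphProduct Γ M} (h : head u x = 1) : tail u x = x := by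
  conv_rhs => rw [← of_head_mul_tail u x, h, map_one, one_mul]

theorem support_of_mul {u : V} {m : M u} (hm : m ≠ 1) {x : GraphProduct Γ M}
    (h : head u x = 1) : support (of u m * x) = insert u (support x) := by
  rw [support, normalForm_of_mul, NormalForm.support_push_of_head_eq_one hm h, support]

theorem support_tail_subset (u : V) (x : GraphProduct Γ M) : support (tail u x) ⊆ support x := by
  by_cases h : head u x = 1
  · rw [tail_eq_self h]
  · conv_rhs => rw [← of_head_mul_tail u x, support_of_mul h (head_tail u x)]
    exact Set.subset_insert _ _

theorem support_subset_insert_tail (u : V) (x : GraphProduct Γ M) :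
    support x ⊆ insert u (support (tail u x)) := by
  by_cases h : head u x = 1
  · rw [tail_eq_self h]
    exact Set.subset_insert _ _
  · conv_lhs => rw [← of_head_mul_tail u x, support_of_mul h (head_tail u x)]

theorem support_of_mul_subset (u : V) (m : M u) (x : GraphProduct Γ M) :
    support (of u m * x) ⊆ insert u (support x) := by
  refine (support_subset_insert_tail u _).trans (Set.insert_subset_insert ?_)
  rw [tail_of_mul_self]
  exact support_tail_subset u x

theorem support_subset_insert_of_mul (u : V) (m : M u) (x : GraphProduct Γ M) :
    support x ⊆ insert u (support (of u m * x)) := by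
  refine (support_subset_insert_tail u _).trans (Set.insert_subset_insert ?_)
  rw [← tail_of_mul_self u m]
  exact support_tail_subset u _

theorem mem_support_of_head_ne_one {u : V} {x : GraphProduct Γ M} (h : head u x ≠ 1) :
    u ∈ support x := by
  rw [← of_head_mul_tail u x, support_of_mul h (head_tail u x)]
  exact Set.mem_insert _ _

theorem head_eq_one_of_notMem {u : V} {x : GraphProduct Γ M} (h : u ∉ support x) :
    head u x = 1 :=
  by_contra fun h' => h (mem_support_of_head_ne_one h')

/-- The tails at `u` agree, and the heads agree after cancelling `m` in `M u`. -/
theorem of_mul_cancel {u : V} [IsLeftCancelMul (M u)] (m : M u) {x y : GraphProduct Γ M}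
    (h : of u m * x = of u m * y) : x = y := by
  have h₁ := congrArg (head u) h
  have h₂ := congrArg (tail u) h
  rw [head_of_mul_self, head_of_mul_self] at h₁
  rw [tail_of_mul_self, tail_of_mul_self] at h₂
  rw [← of_head_mul_tail u x, mul_left_cancel h₁, h₂, of_head_mul_tail]

instance [∀ v, IsLeftCancelMul (M v)] : IsLeftCancelMul (GraphProduct Γ M) where
  mul_left_cancel x := by
    induction x using induction_of with
    | one => exact fun y z h => by simpa using h
    | of_mul v m x ih =>
      intro y z h
      simp only [mul_assoc] at h
      exact ih (of_mul_cancel m h)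

/-- An element supported on a clique with prescribed initial parts there. -/
theorem exists_clique_prod (W : Finset V) (hW : ∀ v ∈ W, ∀ w ∈ W, v ≠ w → Γ.Adj v w)
    (x : ∀ v, M v) : ∃ k : GraphProduct Γ M, support k ⊆ W ∧ (∀ w ∈ W, head w k = x w) ∧
      ∀ w ∈ W, support (tail w k) ⊆ (W : Set V) \ {w} := by
  classical
  induction W using Finset.induction_on with
  | empty => exact ⟨1, by simp [support_one]⟩
  | insert a W ha ih =>
    obtain ⟨k, hk, hx, ht⟩ := ih fun v hv w hw => hW v (by simp [hv]) w (by simp [hw])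
    have hadj : ∀ w ∈ W, Γ.Adj a w := fun w hw =>
      hW a (by simp) w (by simp [hw]) fun h => ha (h ▸ hw)
    have hak : head a k = 1 := head_eq_one_of_notMem fun h => ha (hk h)
    refine ⟨of a (x a) * k, ?_, ?_, ?_⟩
    · rw [Finset.coe_insert]
      exact (support_of_mul_subset _ _ _).trans (Set.insert_subset_insert hk)
    · intro w hw
      obtain rfl | hw := Finset.mem_insert.1 hw
      · rw [head_of_mul_self, hak, mul_one]
      · rw [head_of_mul_adj (hadj w hw), hx w hw]
    · intro w hw
      obtain rfl | hw := Finset.mem_insert.1 hw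
      · rw [tail_of_mul_self, tail_eq_self hak]
        exact fun v hv => ⟨by simpa using .inr (hk hv), fun h => ha (h ▸ hk hv)⟩
      · rw [tail_of_mul_adj (hadj w hw)]
        refine (support_of_mul_subset _ _ _).trans (Set.insert_subset ?_ fun v hv => ?_)
        · exact ⟨by simp, fun h => ha (by rw [Set.mem_singleton_iff.1 h]; exact hw)⟩
        · exact ⟨by simpa using .inr (ht w hw hv).1, (ht w hw hv).2⟩

end Elements

end GraphProduct

/-! ### Constructible right ideals of a graph product. -/

theorem IsConstructibleRightIdeal.mul_mem {P : Type*} [Semigroup P] {X : Set P}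
    (hX : IsConstructibleRightIdeal X) {x : P} (hx : x ∈ X) (y : P) : x * y ∈ X := by
  induction hX generalizing x with
  | whole => trivial
  | image p _ ih =>
    obtain ⟨z, hz, rfl⟩ := hx
    exact ⟨z * y, ih hz, (mul_assoc _ _ _).symm⟩
  | @preimage q X _ ih =>
    change q * (x * y) ∈ X
    rw [← mul_assoc]
    exact ih hx

theorem IsConstructibleRightIdeal.eq_univ {P : Type*} [Monoid P] {X : Set P}
    (hX : IsConstructibleRightIdeal X) (h : 1 ∈ X) : X = Set.univ :=
  Set.eq_univ_of_forall fun y => one_mul y ▸ hX.mul_mem h y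

namespace GraphProduct

theorem finite_update {V : Type*} [DecidableEq V] {M : V → Type*}
    {I : ∀ v, Set (M v)} (hfin : {v | I v ≠ Set.univ}.Finite) (v : V) (S : Set (M v)) : {w | Function.update I v S w ≠ Set.univ}.Finite := by
  refine (hfin.insert v).subset fun w hw => ?_
  by_cases h : w = v
  · exact .inl h
  · exact .inr (by simpa [h] using hw)

section Ideals

variable {V : Type*} (Γ : SimpleGraph V) {M : V → Type*} [∀ v, Monoid (M v)]

/-- The elements whose initial parts at all vertices are in prescribed sets. -/
def cylinder (I : ∀ v, Set (M v)) : Set (GraphProduct Γ M) := {x | ∀ v, head v x ∈ I v}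

/-- The sets in terms of which the constructible right ideals of a graph product are described. -/
inductive IsStandard : Set (GraphProduct Γ M) → Prop
  | empty : IsStandard ∅
  | cylinder (I : ∀ v, Set (M v)) (hI : ∀ v, IsConstructibleRightIdeal (I v))
      (hfin : {v | I v ≠ Set.univ}.Finite) : IsStandard (cylinder Γ I)
  | shift (u : V) (m : M u) (hm : m ≠ 1) (X : Set (GraphProduct Γ M)) (hX : IsStandard X)
      (hhead : ∀ x ∈ X, head u x = 1) (hsupp : ∀ x ∈ X, ¬ support x ⊆ {w | Γ.Adj u w}) :
      IsStandard ((fun x => of u m * x) '' X)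

variable {Γ}

theorem image_of_one (u : V) (X : Set (GraphProduct Γ M)) :
    (fun x => of u (1 : M u) * x) '' X = X := by
  simp

theorem head_ne_one_of_mem_cylinder {I : ∀ v, Set (M v)}
    (hI : ∀ v, IsConstructibleRightIdeal (I v)) {w : V} (hw : I w ≠ Set.univ)
    {x : GraphProduct Γ M} (hx : x ∈ cylinder Γ I) : head w x ≠ 1 := fun h =>
  hw ((hI w).eq_univ (h ▸ hx w))

theorem forall_update [DecidableEq V] {I : ∀ v, Set (M v)}
    (hI : ∀ v, IsConstructibleRightIdeal (I v)) {v : V} {S : Set (M v)}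
    (hS : IsConstructibleRightIdeal S) (w : V) :
    IsConstructibleRightIdeal (Function.update I v S w) := by
  by_cases h : w = v
  · subst h
    simpa using hS
  · simpa [h] using hI w

/-- If `I` is trivial away from `v` and its neighbours, then membership in the cylinder over `I`
with changed component at `v` does not change under multiplication at `v`. -/
theorem forall_head_mem_iff {I : ∀ v, Set (M v)} {v : V}
    (h : ∀ w, I w ≠ Set.univ → w ≠ v → Γ.Adj v w) (q : M v) (y : GraphProduct Γ M) :
    (∀ w, w ≠ v → head w (of v q * y) ∈ I w) ↔ ∀ w, w ≠ v → head w y ∈ I w := by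
  refine forall₂_congr fun w hw => ?_
  by_cases hu : I w = Set.univ
  · simp [hu]
  · rw [head_of_mul_adj (h w hu hw)]

theorem mem_cylinder_update [DecidableEq V] {I : ∀ v, Set (M v)} {v : V} {S : Set (M v)}
    {x : GraphProduct Γ M} :
    x ∈ cylinder Γ (Function.update I v S) ↔ head v x ∈ S ∧ ∀ w, w ≠ v → head w x ∈ I w := by
  constructor
  · intro h
    refine ⟨by simpa using h v, fun w hw => by simpa [hw] using h w⟩
  · rintro ⟨h₁, h₂⟩ w
    by_cases hw : w = v
    · subst hw
      simpa using h₁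
    · simpa [hw] using h₂ w hw

theorem mem_cylinder_iff_at (v : V) {I : ∀ v, Set (M v)} {x : GraphProduct Γ M} :
    x ∈ cylinder Γ I ↔ head v x ∈ I v ∧ ∀ w, w ≠ v → head w x ∈ I w := by
  classical
  rw [← mem_cylinder_update, Function.update_eq_self]

theorem image_cylinder [DecidableEq V] {I : ∀ v, Set (M v)} {v : V}
    (h : ∀ w, I w ≠ Set.univ → w ≠ v → Γ.Adj v w) (q : M v) :
    (fun x => of v q * x) '' cylinder Γ I =
      cylinder Γ (Function.update I v ((fun x => q * x) '' I v)) := by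
  ext z
  rw [mem_cylinder_update]
  constructor
  · rintro ⟨x, hx, rfl⟩
    rw [mem_cylinder_iff_at v] at hx
    refine ⟨⟨_, hx.1, by simp⟩, (forall_head_mem_iff h q x).2 hx.2⟩
  · rintro ⟨⟨i, hi, hiz⟩, hz⟩
    have hqz : of v q * (of v i * tail v z) = z := by
      conv_rhs => rw [← of_head_mul_tail v z, ← hiz, map_mul, mul_assoc]
    refine ⟨of v i * tail v z, (mem_cylinder_iff_at v).2 ⟨by simpa using hi, ?_⟩, hqz⟩
    rw [← hqz] at hz
    exact (forall_head_mem_iff h q _).1 hz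

theorem preimage_cylinder [DecidableEq V] {I : ∀ v, Set (M v)} {v : V}
    (h : ∀ w, I w ≠ Set.univ → w ≠ v → Γ.Adj v w) (q : M v) :
    (fun x => of v q * x) ⁻¹' cylinder Γ I =
      cylinder Γ (Function.update I v ((fun x => q * x) ⁻¹' I v)) := by
  ext z
  rw [mem_cylinder_update, Set.mem_preimage, mem_cylinder_iff_at v, forall_head_mem_iff h,
    head_of_mul_self, Set.mem_preimage]

/-- If every vertex that is forced to be initial in `X` is `v` or adjacent to `v`, the new syllable
is absorbed by a cylinder, merged, or commuted past the outer shift. Otherwise a nonadjacent initial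
vertex makes the head at `v` trivial and supplies the syllable that a new shift requires. -/
theorem IsStandard.image_of {X : Set (GraphProduct Γ M)} (hX : IsStandard Γ X) (v : V)
    (q : M v) : IsStandard Γ ((fun x => of v q * x) '' X) := by
  classical
  by_cases hq : q = 1
  · subst hq
    rwa [image_of_one]
  induction hX with
  | empty => simpa using .empty
  | cylinder I hI hfin =>
    by_cases h : ∀ w, I w ≠ Set.univ → w ≠ v → Γ.Adj v w
    · rw [image_cylinder h]
      exact .cylinder _ (forall_update hI (.image q (hI v))) (finite_update hfin v _)
    · push Not at h
      obtain ⟨w, hw, hne, hadj⟩ := h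
      refine .shift v q hq _ (.cylinder I hI hfin) (fun x hx => ?_) fun x hx hs => ?_
      · exact head_eq_one_of_not_adj hne (fun h => hadj h.symm)
          (head_ne_one_of_mem_cylinder hI hw hx)
      · exact hadj (hs (mem_support_of_head_ne_one (head_ne_one_of_mem_cylinder hI hw hx)))
  | shift u m hm X hX hhead hsupp ih =>
    by_cases huv : u = v
    · subst huv
      rw [Set.image_image]
      simp only [← mul_assoc, ← map_mul]
      by_cases hqm : q * m = 1
      · rw [hqm, image_of_one]
        exact hX
      · exact .shift u _ hqm X hX hhead hsupp
    by_cases hadj : Γ.Adj v u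
    · rw [Set.image_image]
      simp only [of_mul_left_comm hadj]
      rw [← Set.image_image (fun x => of u m * x) (fun x => of v q * x)]
      refine .shift u m hm _ ih ?_ ?_
      · rintro _ ⟨x, hx, rfl⟩
        change head u (of v q * x) = 1
        rw [head_of_mul_adj hadj, hhead x hx]
      · rintro _ ⟨x, hx, rfl⟩ hs
        refine hsupp x hx ((support_subset_insert_of_mul v q x).trans ?_)
        exact Set.insert_subset hadj.symm hs
    · have hne : ∀ x ∈ X, head u (of u m * x) ≠ 1 := fun x hx => by
        rwa [head_of_mul_self, hhead x hx, mul_one]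
      refine .shift v q hq _ (.shift u m hm X hX hhead hsupp) ?_ ?_
      · rintro _ ⟨x, hx, rfl⟩
        exact head_eq_one_of_not_adj huv (fun h => hadj h.symm) (hne x hx)
      · rintro _ ⟨x, hx, rfl⟩ hs
        exact hadj (hs (mem_support_of_head_ne_one (hne x hx)))

variable [∀ v, IsLeftCancelMul (M v)]

/-- If `q` is not invertible, `of v q * x` always has a nontrivial head at `v`, so the preimage is
empty as soon as `X` forces an initial vertex that is distinct from `v` and not adjacent to it. -/
theorem IsStandard.preimage_of {X : Set (GraphProduct Γ M)} (hX : IsStandard Γ X) (v : V)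
    (q : M v) : IsStandard Γ ((fun x => of v q * x) ⁻¹' X) := by
  classical
  by_cases hq : ∃ r, q * r = 1
  · obtain ⟨r, hqr⟩ := hq
    -- By left cancellation `r` is a two-sided inverse, so the preimage under `q` is the image under
    -- `r`.
    have hrq : r * q = 1 := mul_left_cancel (a := q) (by rw [← mul_assoc, hqr, one_mul, mul_one])
    rw [← Set.image_eq_preimage_of_inverse (f := fun x => of v r * x)]
    · exact hX.image_of v r
    · intro x
      simp only [← mul_assoc, ← map_mul, hqr, map_one, one_mul]
    · intro x
      simp only [← mul_assoc, ← map_mul, hrq, map_one, one_mul]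
  have key : ∀ x : GraphProduct Γ M, head v (of v q * x) ≠ 1 := fun x h =>
    hq ⟨_, (head_of_mul_self v q x).symm.trans h⟩
  induction hX with
  | empty => simpa using .empty
  | cylinder I hI hfin =>
    by_cases h : ∀ w, I w ≠ Set.univ → w ≠ v → Γ.Adj v w
    · rw [preimage_cylinder h]
      exact .cylinder _ (forall_update hI (.preimage q (hI v))) (finite_update hfin v _)
    · push Not at h
      obtain ⟨w, hw, hne, hadj⟩ := h
      convert IsStandard.empty
      refine Set.eq_empty_of_forall_notMem fun x hx => key x ?_
      exact head_eq_one_of_not_adj hne (fun h => hadj h.symm)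
        (head_ne_one_of_mem_cylinder hI hw hx)
  | shift u m hm X hX hhead hsupp ih =>
    by_cases huv : u = v
    · subst huv
      by_cases hm' : ∃ m', q * m' = m
      · obtain ⟨m', rfl⟩ := hm'
        convert hX.image_of u m' using 1
        rw [← Set.preimage_image_eq ((fun x => of u m' * x) '' X)
          (f := fun x : GraphProduct Γ M => of u q * x) fun _ _ h => of_mul_cancel q h,
          Set.image_image]
        simp only [← mul_assoc, ← map_mul]
      · convert IsStandard.empty
        refine Set.eq_empty_of_forall_notMem ?_
        rintro y ⟨x, hx, hxy⟩
        have := congrArg (head u) hxy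
        simp only [head_of_mul_self, hhead x hx, mul_one] at this
        exact hm' ⟨_, this.symm⟩
    by_cases hadj : Γ.Adj v u
    · have himage : (fun x => of v q * x) ⁻¹' ((fun x => of u m * x) '' X) =
          (fun x => of u m * x) '' ((fun x => of v q * x) ⁻¹' X) := by
        ext y
        constructor
        · rintro ⟨x, hx, hxy⟩
          have h₁ := congrArg (head u) hxy
          have h₂ := congrArg (tail u) hxy
          simp only [head_of_mul_self, hhead x hx, mul_one, head_of_mul_adj hadj] at h₁
          simp only [tail_of_mul_self, tail_eq_self (hhead x hx), tail_of_mul_adj hadj] at h₂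
          refine ⟨tail u y, ?_, ?_⟩
          · change of v q * tail u y ∈ X
            rwa [← h₂]
          · change of u m * tail u y = y
            rw [h₁, of_head_mul_tail]
        · rintro ⟨x, hx, rfl⟩
          exact ⟨of v q * x, hx, of_mul_left_comm hadj.symm _ _ _⟩
      rw [himage]
      refine .shift u m hm _ ih ?_ ?_
      · intro x hx
        rw [← head_of_mul_adj hadj q, hhead _ hx]
      · intro x hx hs
        refine hsupp _ hx ((support_of_mul_subset v q x).trans ?_)
        exact Set.insert_subset hadj.symm hs
    · convert IsStandard.empty
      refine Set.eq_empty_of_forall_notMem ?_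
      rintro y ⟨x, hx, hxy⟩
      refine key y ?_
      simp only at hxy
      rw [← hxy]
      exact head_eq_one_of_not_adj huv (fun h => hadj h.symm)
        (by rwa [head_of_mul_self, hhead x hx, mul_one])

theorem isStandard_of_isConstructible {X : Set (GraphProduct Γ M)}
    (hX : IsConstructibleRightIdeal X) : IsStandard Γ X := by
  induction hX with
  | whole =>
    convert IsStandard.cylinder (Γ := Γ) (M := M) (fun _ => Set.univ) (fun _ => .whole) (by simp)
    simp [GraphProduct.cylinder]
  | image p _ ih =>
    induction p using induction_of with
    | one => simpa using ih
    | of_mul v m p ih' =>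
      convert ih'.image_of v m using 1
      simp only [Set.image_image, mul_assoc]
  | @preimage q X _ ih =>
    -- The set must vary: the preimage under `of v m * q` is the preimage under `q` of the preimage
    -- under `of v m`.
    induction q using induction_of generalizing X with
    | one => simpa using ih
    | of_mul v m q ih' =>
      convert ih' (.preimage (of v m) ‹_›) (ih.preimage_of v m) using 1
      simp only [← Set.preimage_comp, Function.comp_def, mul_assoc]

end Ideals

end GraphProduct

/-- Independence in contrapositive form. Since `X` is nonempty, the family `Y` may be empty. -/
theorem SatisfiesIndependence.exists_notMem {P : Type*} [Semigroup P]
    (hP : SatisfiesIndependence P) {X : Set P} (hX : IsConstructibleRightIdeal X)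
    (hne : X.Nonempty) {ι : Type*} [Finite ι] (Y : ι → Set P)
    (hY : ∀ i, IsConstructibleRightIdeal (Y i)) (hYX : ∀ i, Y i ⊂ X) :
    ∃ x ∈ X, ∀ i, x ∉ Y i := by
  obtain ⟨n, ⟨e⟩⟩ := Finite.exists_equiv_fin ι
  by_contra! h
  obtain ⟨x, hx⟩ := hne
  obtain ⟨i₀, -⟩ := h x hx
  have hn : 1 ≤ n := Nat.one_le_iff_ne_zero.2 fun h0 => by
    subst h0
    exact (e i₀).elim0
  obtain ⟨i, hi⟩ := hP.eq_of_eq_iUnion n X (fun i => Y (e.symm i)) hn hX (fun i => hY _) <| by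
    refine Set.Subset.antisymm (fun y hy => ?_) (Set.iUnion_subset fun i => (hYX _).subset)
    obtain ⟨i, hi⟩ := h y hy
    exact Set.mem_iUnion.2 ⟨e i, by simpa using hi⟩
  exact (hYX _).ne hi.symm

namespace GraphProduct

/-! ### Independence of the graph product. -/

section Independence

variable {V : Type*} {Γ : SimpleGraph V} {M : V → Type*} [∀ v, Monoid (M v)]

/-- An element supported on a clique, with tails as in `exists_clique_prod`, is in no shift. -/
theorem IsStandard.exists_cylinder_of_clique {X : Set (GraphProduct Γ M)} (hX : IsStandard Γ X)
    {W : Set V} (hW : ∀ v ∈ W, ∀ w ∈ W, v ≠ w → Γ.Adj v w) {k : GraphProduct Γ M}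
    (hk : support k ⊆ W) (ht : ∀ w ∈ W, support (tail w k) ⊆ W \ {w}) (hkX : k ∈ X) :
    ∃ I : ∀ v, Set (M v), (∀ v, IsConstructibleRightIdeal (I v)) ∧ X = GraphProduct.cylinder Γ I := by
  cases hX with
  | empty => exact hkX.elim
  | cylinder I hI hfin => exact ⟨I, hI, rfl⟩
  | shift u m hm X hX hhead hsupp =>
    obtain ⟨x, hx, rfl⟩ := hkX
    have hu : u ∈ W := hk (mem_support_of_head_ne_one (by
      rwa [head_of_mul_self, hhead x hx, mul_one]))
    have hsub := ht u hu
    simp only [tail_of_mul_self, tail_eq_self (hhead x hx)] at hsub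
    exact (hsupp x hx fun w hw => hW u hu w (hsub hw).1 fun h => (hsub hw).2 h.symm).elim

/-- One generic element, a product over the clique of proper conditions, detects which member of the
union is everything. -/
theorem exists_eq_of_cylinder_eq_iUnion (hM : ∀ v, SatisfiesIndependence (M v))
    {I : ∀ v, Set (M v)} (hI : ∀ v, IsConstructibleRightIdeal (I v))
    (hfin : {v | I v ≠ Set.univ}.Finite) (hne : (cylinder Γ I).Nonempty) {n : ℕ}
    {Y : Fin n → Set (GraphProduct Γ M)} (hY : ∀ i, IsStandard Γ (Y i))
    (h : cylinder Γ I = ⋃ i, Y i) : ∃ i, cylinder Γ I = Y i := by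
  classical
  obtain ⟨z, hz⟩ := hne
  set W := hfin.toFinset with hWdef
  have hmemW : ∀ v, v ∈ W ↔ I v ≠ Set.univ := fun v => by simp [hWdef]
  have hW : ∀ v ∈ W, ∀ w ∈ W, v ≠ w → Γ.Adj v w := fun v hv w hw hvw => by
    by_contra hadj
    exact head_ne_one_of_mem_cylinder hI ((hmemW w).1 hw) hz
      (head_eq_one_of_not_adj hvw hadj
        (head_ne_one_of_mem_cylinder hI ((hmemW v).1 hv) hz))
  -- The conditions `J i` are fixed before the generic element, as it must avoid them. If `Y i` is
  -- not a cylinder, the default `I` imposes nothing, not being strictly smaller than itself.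
  have hJ : ∀ i, ∃ J : ∀ v, Set (M v),
      (∃ J : ∀ v, Set (M v), (∀ v, IsConstructibleRightIdeal (J v)) ∧ Y i = cylinder Γ J) →
        (∀ v, IsConstructibleRightIdeal (J v)) ∧ Y i = cylinder Γ J := fun i => by
    by_cases hi : ∃ J : ∀ v, Set (M v),
      (∀ v, IsConstructibleRightIdeal (J v)) ∧ Y i = cylinder Γ J
    · exact ⟨hi.choose, fun _ => hi.choose_spec⟩
    · exact ⟨I, fun h => (hi h).elim⟩
  choose J hJ using hJ
  have hx : ∀ v, ∃ x ∈ I v,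
      ∀ i, IsConstructibleRightIdeal (J i v) → J i v ⊂ I v → x ∉ J i v := fun v => by
    obtain ⟨x, hx, hxJ⟩ := (hM v).exists_notMem (hI v) ⟨_, hz v⟩
      (ι := {i // IsConstructibleRightIdeal (J i v) ∧ J i v ⊂ I v}) (fun i => J i v)
      (fun i => i.2.1) (fun i => i.2.2)
    exact ⟨x, hx, fun i h₁ h₂ => hxJ ⟨i, h₁, h₂⟩⟩
  choose x hxI hxJ using hx
  have hhead : ∀ {k : GraphProduct Γ M}, support k ⊆ W → ∀ v, v ∉ W → head v k = 1 :=
    fun hk v hv => head_eq_one_of_notMem fun h' => hv (hk h')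
  obtain ⟨k, hk, hkx, hkt⟩ := exists_clique_prod W hW x
  have hkI : k ∈ cylinder Γ I := fun v => by
    by_cases hv : v ∈ W
    · rw [hkx v hv]
      exact hxI v
    · rw [not_not.1 fun h' => hv ((hmemW v).2 h')]
      trivial
  obtain ⟨i, hi⟩ := Set.mem_iUnion.1 (h ▸ hkI)
  obtain ⟨hJc, hYJ⟩ := hJ i ((hY i).exists_cylinder_of_clique hW hk hkt hi)
  have hkJ : k ∈ cylinder Γ (J i) := hYJ ▸ hi
  have hsub : cylinder Γ (J i) ⊆ cylinder Γ I := by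
    rw [← hYJ, h]
    exact Set.subset_iUnion Y i
  refine ⟨i, ?_⟩
  rw [hYJ]
  congr 1
  funext v
  by_cases hv : v ∈ W
  · have hJI : J i v ⊆ I v := fun y hy => by
      obtain ⟨k', hk', hkx', -⟩ := exists_clique_prod (Γ := Γ) W hW (Function.update x v y)
      have hmem : k' ∈ cylinder Γ (J i) := fun w => by
        by_cases hw : w ∈ W
        · rw [hkx' w hw]
          by_cases hwv : w = v
          · subst hwv
            simpa using hy
          · have := hkJ w
            rw [hkx w hw] at this
            simpa [hwv] using this
        · rw [hhead hk' w hw, ← hhead hk w hw]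
          exact hkJ w
      have := hsub hmem v
      rwa [hkx' v hv, Function.update_self] at this
    by_contra hne'
    refine hxJ v i (hJc v) (hJI.ssubset_of_ne fun h' => hne' h'.symm) ?_
    rw [← hkx v hv]
    exact hkJ v
  · have h1 := hkJ v
    rw [hhead hk v hv] at h1
    rw [(hJc v).eq_univ h1]
    exact not_not.1 fun h' => hv ((hmemW v).2 h')

/-- For a shift, the preimages of the `Y i` under the outer syllable cover the simpler set. Each `Y
i` lies in the range of that multiplication, so an equality of preimages can be pushed forward
again. -/
theorem IsStandard.exists_eq_of_eq_iUnion (hM : ∀ v, SatisfiesIndependence (M v))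
    {X : Set (GraphProduct Γ M)} (hX : IsStandard Γ X) {n : ℕ} (hn : 1 ≤ n)
    {Y : Fin n → Set (GraphProduct Γ M)} (hY : ∀ i, IsConstructibleRightIdeal (Y i))
    (h : X = ⋃ i, Y i) : ∃ i, X = Y i := by
  have : ∀ v, IsLeftCancelMul (M v) := fun v => (hM v).leftCancel
  by_cases hne : X = ∅
  · refine ⟨⟨0, hn⟩, ?_⟩
    rw [hne] at h ⊢
    exact (Set.iUnion_eq_empty.1 h.symm _).symm
  induction hX generalizing Y with
  | empty => exact (hne rfl).elim
  | cylinder I hI hfin =>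
    exact exists_eq_of_cylinder_eq_iUnion hM hI hfin (Set.nonempty_iff_ne_empty.2 hne)
      (fun i => isStandard_of_isConstructible (hY i)) h
  | shift u m hm X hX hhead hsupp ih =>
    have hXe : X = (fun x => of u m * x) ⁻¹' ((fun x => of u m * x) '' X) :=
      (Set.preimage_image_eq _ fun _ _ h => of_mul_cancel m h).symm
    obtain ⟨i, hi⟩ := ih (Y := fun i => (fun x => of u m * x) ⁻¹' Y i)
      (fun i => .preimage _ (hY i)) (by rw [← Set.preimage_iUnion, ← h, ← hXe])
      (fun h' => hne (by rw [h', Set.image_empty]))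
    refine ⟨i, ?_⟩
    rw [hi]
    refine Set.image_preimage_eq_of_subset fun y hy => ?_
    have hy' := h ▸ Set.mem_iUnion.2 ⟨i, hy⟩
    exact Set.image_subset_range _ X hy'

/-- A graph product of monoids that satisfy independence satisfies independence. -/
theorem satisfiesIndependence (hM : ∀ v, SatisfiesIndependence (M v)) :
    SatisfiesIndependence (GraphProduct Γ M) := by
  have : ∀ v, IsLeftCancelMul (M v) := fun v => (hM v).leftCancel
  exact ⟨inferInstance, fun n X Y hn hX hY h =>
    (isStandard_of_isConstructible hX).exists_eq_of_eq_iUnion hM hn hY h⟩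

end Independence

end GraphProduct

theorem mainTheorem7 {V : Type*} (Γ : SimpleGraph V) (G : V → Type*) [∀ v, Group (G v)]
    (P : ∀ v, Submonoid (G v)) (hP : ∀ v, SatisfiesIndependence (P v)) :
    SatisfiesIndependence (GraphProduct Γ (fun v => P v)) := by
  exact GraphProduct.satisfiesIndependence hP
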